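/- Throughout, $(\mathcal M,\tau)$ denotes a diffuse von Neumann algebra (one without minimal projections) together with a normal faithful tracial state $\tau$. A flag in $(\mathcal M,\tau)$ is a linearly ordered family $e=(e_t)_{0\le t\le 1}$ of projections in $\mathcal M$ with $\tau(e_t)=t$ for all $t\in[0,1]$. For projections $p,q\in\mathcal M$, $p\wedge q$ denotes the projection onto the intersection of their ranges. Let $1\le r\le n$ be integers and let $I=\{i_1<\dots<i_r\}$, $J=\{j_1<\dots<j_r\}$, $K=\{k_1<\dots<k_r\}$ be subsets of $\{1,\dots,n\}$ of cardinality $r$. We say that $(I,J,K)$ has property P$_n$ if for every $(\mathcal M,\tau)$ as above and all flags $e,f,g$ in it there is a projection $p\in\mathcal M$ such that $\tau(p)=\frac rn$ and, for all $\ell\in\{1,\dots,r\}$, $$\tau(e_{i_\ell/n}\wedge p)\ge\tfrac{\ell}{n},\qquad \tau(f_{j_\ell/n}\wedge p)\ge\tfrac{\ell}{n},\qquad \tau(g_{k_\ell/n}\wedge p)\ge\tfrac{\ell}{n}.\qquad(*)$$ We say that $(I,J,K)$ has property AP$_n$ if for all such $(\mathcal M,\tau)$, all flags $e,f,g$ in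 it and every $\varepsilon>0$ there is a projection $p\in\mathcal M$ with $\tau(p)\le\frac rn+\varepsilon$ that satisfies $(*)$ for all $\ell\in\{1,\dots,r\}$. Lemma. Let $1\le r\le n$ and $(I,J,K)$ be as above, put $i_0=j_0=k_0=0$, and let $u,v,w\in\{0,1,\dots,r\}$ satisfy $$i_u+j_v+k_w\le n.$$ For $y\in\{1,\dots,r\}$ let $i'_y=i_y$ if $y\le u$ and $i'_y=i_y+1$ if $y>u$; let $j'_y=j_y$ if $y\le v$ and $j'_y=j_y+1$ if $y>v$; let $k'_y=k_y$ if $y\le w$ and $k'_y=k_y+1$ if $y>w$. Put $I'=\{i'_1,\dots,i'_r\}$, $J'=\{j'_1,\dots,j'_r\}$, $K'=\{k'_1,\dots,k'_r\}$. Then $I',J',K'$ are subsets of $\{1,\dots,n+1\}$ of cardinality $r$; if $(I,J,K)$ has property P$_n$, then $(I',J',K')$ has property P$_{n+1}$; and if $(I,J,K)$ has property AP$_n$, then $(I',J',K')$ has property AP$_{n+1}$. -/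

import Mathlib

universe uH

namespace VNHorn

open scoped InnerProductSpace

section Projections

variable {H : Type uH} [NormedAddCommGroup H] [InnerProductSpace ℂ H] [CompleteSpace H]

/-- The projections (self-adjoint idempotents) of a von Neumann algebra `M` on `H`, ordered by the
usual operator order. -/
abbrev Proj (M : VonNeumannAlgebra H) : Type uH :=
  {p : H →L[ℂ] H // p ∈ M ∧ IsStarProjection p}

/-- A projection, seen as an element of the star-algebra underlying `M`. -/
def Proj.toAlg {M : VonNeumannAlgebra H} (p : Proj M) : M.toStarSubalgebra :=
  ⟨p.1, p.2.1⟩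

theorem hasOrthogonalProjection_inf {p q : H →L[ℂ] H} (hp : IsStarProjection p)
    (hq : IsStarProjection q) : (p.range ⊓ q.range).HasOrthogonalProjection := by
  have hc : IsClosed ((p.range ⊓ q.range : Submodule ℂ H) : Set H) :=
    (ContinuousLinearMap.IsIdempotentElem.isClosed_range hp.isIdempotentElem).inter
      (ContinuousLinearMap.IsIdempotentElem.isClosed_range hq.isIdempotentElem)
  have := hc.completeSpace_coe
  exact Submodule.HasOrthogonalProjection.ofCompleteSpace _

/-- `p ∧ q`: the orthogonal projection onto `pH ∩ qH`. -/
noncomputable def Proj.meet {M : VonNeumannAlgebra H} (p q : Proj M) : Proj M :=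
  haveI := hasOrthogonalProjection_inf p.2.2 q.2.2
  ⟨(p.1.range ⊓ q.1.range).starProjection, by
    have hs : IsStarProjection (p.1.range ⊓ q.1.range).starProjection :=
      isStarProjection_starProjection
    refine ⟨(VonNeumannAlgebra.IsStarProjection.mem_iff hs M).2 fun y hy => ?_, hs⟩
    rw [Submodule.range_starProjection]
    exact Module.End.invtSubmodule.inf_mem
      ((VonNeumannAlgebra.IsStarProjection.mem_iff p.2.2 M).1 p.2.1 y hy)
      ((VonNeumannAlgebra.IsStarProjection.mem_iff q.2.2 M).1 q.2.1 y hy)⟩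

/-- `M` is diffuse: it has no minimal projections. -/
def IsDiffuse (M : VonNeumannAlgebra H) : Prop :=
  ∀ p : Proj M, p.1 ≠ 0 → ∃ q : Proj M, q ≤ p ∧ q.1 ≠ 0 ∧ q ≠ p

/-- `τ` is a normal faithful tracial state on `M`. Normality is continuity for the ultraweak
(σ-weak) topology, i.e. `τ` is a vector functional `x ↦ ∑ ⟨ξ n, x (η n)⟩` with
square-summable sequences of vectors `ξ`, `η`. -/
structure IsNormalFaithfulTracialState (M : VonNeumannAlgebra H)
    (τ : M.toStarSubalgebra →ₗ[ℂ] ℂ) : Prop where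
  map_one : τ 1 = 1
  nonneg_re : ∀ x, 0 ≤ (τ (star x * x)).re
  nonneg_im : ∀ x, (τ (star x * x)).im = 0
  faithful : ∀ x, τ (star x * x) = 0 → x = 0
  tracial : ∀ x y, τ (x * y) = τ (y * x)
  normal : ∃ ξ η : ℕ → H, Summable (fun n => ‖ξ n‖ ^ 2) ∧ Summable (fun n => ‖η n‖ ^ 2) ∧
    ∀ x : M.toStarSubalgebra, HasSum (fun n => ⟪ξ n, x.1 (η n)⟫_ℂ) (τ x)

/-- The (real) trace of a projection. -/
noncomputable def tr {M : VonNeumannAlgebra H} (τ : M.toStarSubalgebra →ₗ[ℂ] ℂ)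
    (p : Proj M) : ℝ :=
  (τ p.toAlg).re

/-- `(e t)`, `0 ≤ t ≤ 1`, is a flag: a linearly ordered family of projections with
`τ (e t) = t`. Only the values at `t ∈ [0, 1]` matter. -/
def IsFlag {M : VonNeumannAlgebra H} (τ : M.toStarSubalgebra →ₗ[ℂ] ℂ) (e : ℝ → Proj M) : Prop :=
  (∀ s ∈ Set.Icc (0 : ℝ) 1, ∀ t ∈ Set.Icc (0 : ℝ) 1, e s ≤ e t ∨ e t ≤ e s) ∧
    ∀ t ∈ Set.Icc (0 : ℝ) 1, tr τ (e t) = t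

end Projections

/-- The elements of `I = {i₁ < i₂ < ⋯ < i_r}`: `idx I l = i_l` for `1 ≤ l ≤ r`, and
`idx I 0 = 0`. -/
noncomputable def idx (I : Finset ℕ) : ℕ → ℕ
  | 0 => 0
  | l + 1 => Nat.nth (· ∈ I) l

/-- `I` is a subset of `{1, …, n}` with exactly `r` elements. -/
def IsIndexSet (n r : ℕ) (I : Finset ℕ) : Prop :=
  I ⊆ Finset.Icc 1 n ∧ I.card = r

/-- `τ (e_{i_l / n} ∧ p) ≥ l / n` for `l = 1, …, r`. -/
def MeetsFlag {H : Type uH} [NormedAddCommGroup H] [InnerProductSpace ℂ H] [CompleteSpace H]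
    {M : VonNeumannAlgebra H} (τ : M.toStarSubalgebra →ₗ[ℂ] ℂ)
    (n r : ℕ) (I : Finset ℕ) (e : ℝ → Proj M) (p : Proj M) : Prop :=
  ∀ l ∈ Finset.Icc 1 r, (l : ℝ) / n ≤ tr τ ((e ((idx I l : ℝ) / n)).meet p)

/-- Property `P_n` of a triple `(I, J, K)` of `r`-element subsets of `{1, …, n}`. -/
def PropertyP (n r : ℕ) (I J K : Finset ℕ) : Prop :=
  ∀ (H : Type uH) [NormedAddCommGroup H] [InnerProductSpace ℂ H] [CompleteSpace H]
    (M : VonNeumannAlgebra H) (τ : M.toStarSubalgebra →ₗ[ℂ] ℂ),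
    IsDiffuse M → IsNormalFaithfulTracialState M τ →
    ∀ e f g : ℝ → Proj M, IsFlag τ e → IsFlag τ f → IsFlag τ g →
      ∃ p : Proj M, tr τ p = (r : ℝ) / n ∧
        MeetsFlag τ n r I e p ∧ MeetsFlag τ n r J f p ∧ MeetsFlag τ n r K g p

/-- Property `AP_n` of a triple `(I, J, K)` of `r`-element subsets of `{1, …, n}`. -/
def PropertyAP (n r : ℕ) (I J K : Finset ℕ) : Prop :=
  ∀ (H : Type uH) [NormedAddCommGroup H] [InnerProductSpace ℂ H] [CompleteSpace H]
    (M : VonNeumannAlgebra H) (τ : M.toStarSubalgebra →ₗ[ℂ] ℂ),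
    IsDiffuse M → IsNormalFaithfulTracialState M τ →
    ∀ e f g : ℝ → Proj M, IsFlag τ e → IsFlag τ f → IsFlag τ g →
      ∀ ε : ℝ, 0 < ε → ∃ p : Proj M, tr τ p ≤ (r : ℝ) / n + ε ∧
        MeetsFlag τ n r I e p ∧ MeetsFlag τ n r J f p ∧ MeetsFlag τ n r K g p

/-- The set `{i'_1, …, i'_r}` with `i'_y = i_y` for `y ≤ u` and `i'_y = i_y + 1` for `y > u`. -/
noncomputable def shift (r : ℕ) (I : Finset ℕ) (u : ℕ) : Finset ℕ :=
  (Finset.Icc 1 r).image fun y => idx I y + if y ≤ u then 0 else 1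

end VNHorn

/-!
Let `(M, τ)` and flags `e`, `f`, `g` be given. The three projections `e (i_u / (n + 1))`,
`f (j_v / (n + 1))`, `g (k_w / (n + 1))` have traces adding up to at most `n / (n + 1)`, so they lie
below a common projection `q ∈ M` of trace `n / (n + 1)` (`exists_ge_of_tr_add_le`). The hypothesis
on `(I, J, K)` is applied to the corner `qMq`, acting on the range of `q`, with the renormalized
trace, and the projection found there is regarded as a projection of `M`.

The flag used in the corner is obtained from the chain of projections `q ∧ e s`
(`IsFlag.exists_corner`): it is a flag `e'` such that `e' t ≤ q ∧ e s` whenever the trace of the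
right-hand side in the corner is at least `t`. For `l ≤ u` the projection `e (i_l / (n + 1))` is
below `q` and has normalized trace `i_l / n` there. For `l > u` the trace of
`q ∧ e ((i_l + 1) / (n + 1))` is at least `τ(q) + (i_l + 1) / (n + 1) - 1 = i_l / (n + 1)`. In both
cases `e' (i_l / n) ≤ e (i'_l / (n + 1))`, so that the inequalities for `I` in the corner give those
for the shifted set in `M` (`exists_corner_flag_meetsFlag`).

Three facts on von Neumann algebras are needed.
* `τ(p ∧ q) ≥ τ(p) + τ(q) - 1` (`IsNormalFaithfulTracialState.tr_meet_ge`). The averages of the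
  powers of `pqp` converge strongly to `p ∧ q` by the mean ergodic theorem, and the difference of
  the traces of `(pqp) ^ k` and `((1 - q)(1 - p)(1 - q)) ^ k` is `τ(p) + τ(q) - 1` for all `k ≥ 1`.
* Any chain of projections in a diffuse algebra extends to one on which `τ` takes all values in
  `[0, 1]` (`exists_isFlag_of_isChain`). A maximal chain has this property
  (`IsSaturatedChain.exists_tr_eq`): at a missing value, the projections of the chain just below and
  just above, which exist by normality, would differ by a minimal projection.
* The corner `qMq` is a diffuse von Neumann algebra on the range of `q`, with a normal faithful
  tracial state (`corner`, `IsDiffuse.corner`, `IsNormalFaithfulTracialState.corner`).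
-/

namespace VNHorn

open scoped InnerProductSpace
open Filter Topology

/-! ### Projections and the trace -/

section Order

variable {H : Type uH} [NormedAddCommGroup H] [InnerProductSpace ℂ H] [CompleteSpace H]
  {M : VonNeumannAlgebra H}

theorem Proj.le_iff_mul_eq_right {p q : Proj M} : p ≤ q ↔ q.1 * p.1 = p.1 :=
  p.2.2.le_iff_mul_eq_right q.2.2

theorem Proj.le_iff_mul_eq_left {p q : Proj M} : p ≤ q ↔ p.1 * q.1 = p.1 :=
  p.2.2.le_iff_mul_eq_left q.2.2

theorem Proj.mem_range_iff {p : Proj M} {x : H} : x ∈ p.1.range ↔ p.1 x = x := by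
  constructor
  · rintro ⟨y, rfl⟩
    exact DFunLike.congr_fun p.2.2.isIdempotentElem y
  · intro h
    exact ⟨x, h⟩

theorem Proj.le_iff_range_le {p q : Proj M} : p ≤ q ↔ p.1.range ≤ q.1.range := by
  rw [Proj.le_iff_mul_eq_right]
  constructor
  · intro h x hx
    rw [Proj.mem_range_iff] at hx ⊢
    rw [← hx]
    exact DFunLike.congr_fun h x
  · intro h
    ext x
    exact Proj.mem_range_iff.1 (h ⟨x, rfl⟩)

theorem Proj.range_meet (p q : Proj M) : (p.meet q).1.range = p.1.range ⊓ q.1.range := by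
  have := hasOrthogonalProjection_inf p.2.2 q.2.2
  exact Submodule.range_starProjection _

theorem Proj.le_meet_iff {p q s : Proj M} : s ≤ p.meet q ↔ s ≤ p ∧ s ≤ q := by
  simp only [Proj.le_iff_range_le, Proj.range_meet, le_inf_iff]

theorem Proj.meet_le_left (p q : Proj M) : p.meet q ≤ p := (Proj.le_meet_iff.1 le_rfl).1

theorem Proj.meet_le_right (p q : Proj M) : p.meet q ≤ q := (Proj.le_meet_iff.1 le_rfl).2

theorem Proj.meet_mono {p q p' q' : Proj M} (h : p ≤ p') (h' : q ≤ q') :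
    p.meet q ≤ p'.meet q' :=
  Proj.le_meet_iff.2 ⟨(Proj.meet_le_left _ _).trans h, (Proj.meet_le_right _ _).trans h'⟩

/-- The complementary projection `1 - p`. -/
def Proj.compl (p : Proj M) : Proj M :=
  ⟨1 - p.1, sub_mem (one_mem M) p.2.1, p.2.2.one_sub⟩

theorem Proj.compl_compl (p : Proj M) : p.compl.compl = p :=
  Subtype.ext (sub_sub_cancel _ _)

theorem Proj.compl_le_compl {p q : Proj M} (h : p ≤ q) : q.compl ≤ p.compl :=
  sub_le_sub_left (show p.1 ≤ q.1 from h) 1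

instance : BoundedOrder (Proj M) where
  top := ⟨1, one_mem M, .one _⟩
  le_top p := p.2.2.le_one
  bot := ⟨0, zero_mem M, .zero _⟩
  bot_le p := p.2.2.nonneg

/-- The difference `q - p` of projections `p ≤ q`. -/
def Proj.diff {p q : Proj M} (h : p ≤ q) : Proj M :=
  ⟨q.1 - p.1, sub_mem q.2.1 p.2.1, (p.2.2.le_iff_sub q.2.2).1 h⟩

/-- The sum of two orthogonal projections. -/
def Proj.add {p q : Proj M} (h : p ≤ q.compl) : Proj M :=
  ⟨p.1 + q.1, add_mem p.2.1 q.2.1, by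
    have h1 : p.1 * (1 - q.1) = p.1 := Proj.le_iff_mul_eq_left.1 h
    refine p.2.2.add q.2.2 ?_
    rw [mul_sub, mul_one, sub_eq_self] at h1
    exact h1⟩

end Order

section Trace

variable {H : Type uH} [NormedAddCommGroup H] [InnerProductSpace ℂ H] [CompleteSpace H]
  {M : VonNeumannAlgebra H} {τ : M.toStarSubalgebra →ₗ[ℂ] ℂ}

theorem tr_diff {p q : Proj M} (h : p ≤ q) : tr τ (Proj.diff h) = tr τ q - tr τ p := by
  have : (Proj.diff h).toAlg = q.toAlg - p.toAlg := rfl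
  simp [tr, this]

theorem tr_bot : tr τ (⊥ : Proj M) = 0 := by
  have : (⊥ : Proj M).toAlg = 0 := rfl
  simp [tr, this]

theorem Proj.star_mul_self_toAlg (p : Proj M) : star p.toAlg * p.toAlg = p.toAlg := by
  apply Subtype.ext
  change star p.1 * p.1 = p.1
  rw [p.2.2.isSelfAdjoint.star_eq, p.2.2.isIdempotentElem.eq]

namespace IsNormalFaithfulTracialState

variable (hτ : IsNormalFaithfulTracialState M τ)
include hτ

theorem tr_compl (p : Proj M) : tr τ p.compl = 1 - tr τ p := by
  have : p.compl.toAlg = 1 - p.toAlg := rfl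
  simp [tr, this, hτ.map_one]

theorem tr_nonneg (p : Proj M) : 0 ≤ tr τ p := by
  rw [tr, ← p.star_mul_self_toAlg]
  exact hτ.nonneg_re _

theorem tr_mono {p q : Proj M} (h : p ≤ q) : tr τ p ≤ tr τ q := by
  have := hτ.tr_nonneg (Proj.diff h)
  rw [tr_diff] at this
  linarith

theorem tr_le_one (p : Proj M) : tr τ p ≤ 1 := by
  have := hτ.tr_nonneg p.compl
  rw [hτ.tr_compl] at this
  linarith

theorem eq_bot_of_tr_eq_zero {p : Proj M} (h : tr τ p = 0) : p = ⊥ := by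
  have h0 : p.toAlg = 0 := by
    apply hτ.faithful
    apply Complex.ext
    · rw [p.star_mul_self_toAlg]
      exact h
    · exact hτ.nonneg_im _
  exact Subtype.ext (congrArg (fun x : M.toStarSubalgebra => x.1) h0)

/-- By faithfulness, comparable projections with the reverse inequality of traces coincide. -/
theorem eq_of_le_of_tr_le {p q : Proj M} (h : p ≤ q) (h' : tr τ q ≤ tr τ p) : p = q := by
  have h0 : Proj.diff h = ⊥ := by
    apply hτ.eq_bot_of_tr_eq_zero
    apply le_antisymm _ (hτ.tr_nonneg _)
    rw [tr_diff]
    linarith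
  have h1 : q.1 - p.1 = 0 := congrArg Subtype.val h0
  exact Subtype.ext (sub_eq_zero.1 h1).symm

/-- A normal state is continuous along bounded strongly convergent sequences. -/
theorem tendsto_of_strongly {a : ℕ → M.toStarSubalgebra} {b : M.toStarSubalgebra} {C : ℝ}
    (hC : ∀ k x, ‖(a k).1 x‖ ≤ C * ‖x‖)
    (hlim : ∀ x, Tendsto (fun k => (a k).1 x) atTop (𝓝 (b.1 x))) :
    Tendsto (fun k => τ (a k)) atTop (𝓝 (τ b)) := by
  obtain ⟨ξ, η, hξ, hη, hsum⟩ := hτ.normal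
  have hC0 : ∀ x : H, 0 ≤ C * ‖x‖ := fun x => (norm_nonneg _).trans (hC 0 x)
  simp_rw [← (hsum _).tsum_eq]
  refine tendsto_tsum_of_dominated_convergence
    (bound := fun n => C * (‖ξ n‖ ^ 2 + ‖η n‖ ^ 2)) ((hξ.add hη).mul_left C)
    (fun n => tendsto_const_nhds.inner (hlim _)) (Eventually.of_forall fun k n => ?_)
  refine (norm_inner_le_norm _ _).trans ?_
  have h1 := hC k (η n)
  rcases (norm_nonneg (η n)).eq_or_lt with h0 | h0
  · have h2 : η n = 0 := norm_eq_zero.1 h0.symm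
    have h3 := hC0 (ξ n)
    simp only [h2, map_zero, norm_zero, mul_zero]
    nlinarith [norm_nonneg (ξ n)]
  · have hCn : 0 ≤ C := nonneg_of_mul_nonneg_left (hC0 (η n)) h0
    nlinarith [norm_nonneg (ξ n), norm_nonneg (η n), sq_nonneg (‖ξ n‖ - ‖η n‖),
      mul_le_mul_of_nonneg_left h1 (norm_nonneg (ξ n)),
      mul_nonneg hCn (sq_nonneg (‖ξ n‖ - ‖η n‖)), mul_nonneg hCn (sq_nonneg (‖ξ n‖)),
      mul_nonneg hCn (sq_nonneg (‖η n‖))]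

/-- A trace is nonnegative on powers of `star y * y`. -/
theorem re_pow_star_mul_self_nonneg (y : M.toStarSubalgebra) (k : ℕ) :
    0 ≤ (τ ((star y * y) ^ k)).re := by
  have hs : star (star y * y) = star y * y := by simp
  rcases Nat.even_or_odd' k with ⟨m, rfl | rfl⟩
  · have : (star y * y) ^ (2 * m) = star ((star y * y) ^ m) * (star y * y) ^ m := by
      rw [star_pow, hs, two_mul, pow_add]
    rw [this]
    exact hτ.nonneg_re _
  · have : (star y * y) ^ (2 * m + 1) = star (y * (star y * y) ^ m) * (y * (star y * y) ^ m) := by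
      rw [star_mul, star_pow, hs, mul_assoc, ← mul_assoc (star y), ← pow_succ', ← pow_add]
      congr 1
      ring
    rw [this]
    exact hτ.nonneg_re _

/-- For idempotents `p`, `q` with complements `p'`, `q'`, the difference of the traces of
`(pqp) ^ k` and `(q'p'q') ^ k` does not depend on `k ≥ 1`: the operator `pq'` intertwines
`pqp` and `q'p'q'`. -/
theorem pow_sub_pow_eq {p q : M.toStarSubalgebra} (hp : p * p = p) (hq : q * q = q) (k : ℕ) :
    τ ((p * q * p) ^ (k + 1)) - τ (((1 - q) * (1 - p) * (1 - q)) ^ (k + 1)) =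
      τ p + τ q - 1 := by
  have hq' : (1 - q) * (1 - q) = 1 - q := by
    simp only [sub_mul, mul_sub, mul_one, one_mul, hq, sub_self, sub_zero]
  obtain ⟨s, hs⟩ : ∃ s, s = 1 - q := ⟨_, rfl⟩
  rw [← hs] at hq' ⊢
  have hqs : q = 1 - s := by rw [hs]; abel
  obtain ⟨a, ha⟩ : ∃ a, a = p * q * p := ⟨_, rfl⟩
  obtain ⟨b, hb⟩ : ∃ b, b = s * (1 - p) * s := ⟨_, rfl⟩
  rw [← ha, ← hb]
  have ha' : a = p - p * s * p := by
    rw [ha, hqs, mul_sub, sub_mul, mul_one, hp]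
  have hb' : b = s - s * p * s := by
    rw [hb, mul_sub, sub_mul, mul_one, hq']
  have hap : a * p = a := by rw [ha, mul_assoc, hp]
  have hsb : s * b = b := by rw [hb, ← mul_assoc, ← mul_assoc, hq']
  have hpa : p - a = p * s * (s * p) := by
    rw [mul_assoc, ← mul_assoc s, hq', ha', sub_sub_cancel, mul_assoc]
  have hsb' : s - b = s * p * (p * s) := by
    rw [mul_assoc, ← mul_assoc p, hp, hb', sub_sub_cancel, mul_assoc]
  have hint : a * (p * s) = p * s * b := by
    rw [← mul_assoc, hap, ha', hb', mul_sub (p * s), mul_assoc p s s, hq', sub_mul]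
    congr 1
    rw [← mul_assoc (p * s) (s * p), ← mul_assoc (p * s) s p, mul_assoc p s s, hq', mul_assoc p s p]
  have hintk : ∀ k, a ^ k * (p * s) = p * s * b ^ k := by
    intro k
    induction k with
    | zero => simp
    | succ k ih => rw [pow_succ, mul_assoc, hint, ← mul_assoc, ih, mul_assoc, ← pow_succ]
  induction k with
  | zero =>
    simp only [zero_add, pow_one]
    have h1 : τ a = τ (p * q) := by rw [ha, hτ.tracial, ← mul_assoc, hp]
    have h2 : τ b = τ (s * (1 - p)) := by rw [hb, hτ.tracial, ← mul_assoc, hq']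
    have h3 : s * (1 - p) = 1 - q - p + q * p := by
      rw [hs, sub_mul, mul_sub]; simp only [one_mul, mul_one, mul_sub]; abel
    rw [h1, h2, h3, map_add, map_sub, map_sub, hτ.map_one, hτ.tracial q p]
    ring
  | succ k ih =>
    have h1 : a ^ (k + 1) - a ^ (k + 1 + 1) = a ^ (k + 1) * (p * s) * (s * p) := by
      rw [mul_assoc, ← hpa, mul_sub, ← pow_succ, pow_succ, mul_assoc _ a p, hap]
    have h2 : τ (a ^ (k + 1) - a ^ (k + 1 + 1)) = τ (b ^ (k + 1) - b ^ (k + 1 + 1)) := by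
      rw [h1, hintk, mul_assoc, hτ.tracial, mul_assoc, ← hsb', mul_sub, ← pow_succ]
      congr 2
      rw [pow_succ, mul_assoc]
      congr 1
      rw [hb, mul_assoc, hq']
    rw [map_sub, map_sub] at h2
    linear_combination ih - h2

/-- In `pow_sub_pow_eq` the second trace is nonnegative, being that of a power of a positive
element. -/
theorem re_pow_ge {p q : Proj M} (k : ℕ) :
    tr τ p + tr τ q - 1 ≤ (τ ((p.toAlg * q.toAlg * p.toAlg) ^ k)).re := by
  have hp : p.toAlg * p.toAlg = p.toAlg := Subtype.ext p.2.2.isIdempotentElem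
  have hq : q.toAlg * q.toAlg = q.toAlg := Subtype.ext q.2.2.isIdempotentElem
  cases k with
  | zero =>
    have h1 := hτ.tr_le_one p
    have h2 := hτ.tr_le_one q
    simp [hτ.map_one]
    linarith
  | succ k =>
    have h := congrArg Complex.re (hτ.pow_sub_pow_eq hp hq k)
    have hb : (1 - q.toAlg) * (1 - p.toAlg) * (1 - q.toAlg) =
        star (p.compl.toAlg * q.compl.toAlg) * (p.compl.toAlg * q.compl.toAlg) := by
      apply Subtype.ext
      change (1 - q.1) * (1 - p.1) * (1 - q.1) =
        star ((1 - p.1) * (1 - q.1)) * ((1 - p.1) * (1 - q.1))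
      have e1 : star (1 - p.1) = 1 - p.1 := p.compl.2.2.isSelfAdjoint
      have e2 : star (1 - q.1) = 1 - q.1 := q.compl.2.2.isSelfAdjoint
      have e3 : (1 - p.1) * (1 - p.1) = 1 - p.1 := p.compl.2.2.isIdempotentElem
      rw [star_mul, e1, e2, mul_assoc, mul_assoc, ← mul_assoc (1 - p.1) (1 - p.1), e3]
    have h3 := hτ.re_pow_star_mul_self_nonneg (p.compl.toAlg * q.compl.toAlg) (k + 1)
    rw [← hb] at h3
    simp only [Complex.sub_re, Complex.add_re, Complex.one_re] at h
    simp only [tr]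
    linarith

end IsNormalFaithfulTracialState

/-- The fixed vectors of `pqp` are the vectors in the ranges of both `p` and `q`. -/
theorem Proj.eqLocus_mul_mul (p q : Proj M) :
    (p.1 * q.1 * p.1).eqLocus (1 : H →L[ℂ] H) = p.1.range ⊓ q.1.range := by
  ext x
  rw [Submodule.mem_inf, Proj.mem_range_iff, Proj.mem_range_iff]
  change p.1 (q.1 (p.1 x)) = x ↔ _
  constructor
  · intro h
    have hp : p.1 x = x := by
      rw [← h]; exact DFunLike.congr_fun p.2.2.isIdempotentElem _
    refine ⟨hp, ?_⟩
    rw [hp] at h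
    -- `‖x‖ ≤ ‖q x‖`, and a vector not shortened by a projection is fixed by it
    have hn : ‖q.1‖ ≤ 1 := q.2.2.norm_le
    have hin : ⟪q.1 x, x⟫_ℂ = (‖x‖ : ℂ) ^ 2 := by
      calc ⟪q.1 x, x⟫_ℂ = ⟪q.1 x, p.1 x⟫_ℂ := by rw [hp]
        _ = ⟪p.1 (q.1 x), x⟫_ℂ := by
          have := p.2.2.isSelfAdjoint.isSymmetric (q.1 x) x
          exact this.symm
        _ = (‖x‖ : ℂ) ^ 2 := by rw [h]; exact inner_self_eq_norm_sq_to_K x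
    refine eq_of_norm_le_re_inner_eq_norm_sq (𝕜 := ℂ) ?_ ?_
    · simpa using q.1.le_of_opNorm_le hn x
    · rw [hin]; norm_cast
  · rintro ⟨hp, hq⟩
    rw [hp, hq, hp]

/-- The averages of the powers of `pqp` converge strongly to `p ∧ q` by the mean ergodic theorem,
and the traces of these powers are at least `τ(p) + τ(q) - 1`. -/
theorem IsNormalFaithfulTracialState.tr_meet_ge (hτ : IsNormalFaithfulTracialState M τ)
    (p q : Proj M) : tr τ p + tr τ q - 1 ≤ tr τ (p.meet q) := by
  set T : M.toStarSubalgebra := p.toAlg * q.toAlg * p.toAlg with hT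
  have hTn : ‖T.1‖ ≤ 1 := by
    change ‖p.1 * q.1 * p.1‖ ≤ 1
    have h1 : ‖p.1‖ ≤ 1 := p.2.2.norm_le
    have h2 : ‖q.1‖ ≤ 1 := q.2.2.norm_le
    calc ‖p.1 * q.1 * p.1‖ ≤ ‖p.1‖ * ‖q.1‖ * ‖p.1‖ := norm_mul₃_le
      _ ≤ 1 * 1 * 1 := by gcongr
      _ = 1 := by norm_num
  -- the averages over `N + 1` powers, which avoids the junk value of the empty average
  let A : ℕ → M.toStarSubalgebra := fun N =>
    ((N + 1 : ℕ) : ℂ)⁻¹ • ∑ k ∈ Finset.range (N + 1), T ^ k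
  have hA : ∀ N x, (A N).1 x = birkhoffAverage ℂ T.1 _root_.id (N + 1) x := by
    intro N x
    have h1 : (A N).1 = ((N + 1 : ℕ) : ℂ)⁻¹ • ∑ k ∈ Finset.range (N + 1), T.1 ^ k := by
      simp [A]
    rw [h1]
    simp only [birkhoffAverage, birkhoffSum, smul_apply,
      sum_apply, id_eq]
    congr 1
    refine Finset.sum_congr rfl fun k _ => ?_
    exact congrFun (FunLike.coe_pow_eq_iterate T.1 k) x
  have hbound : ∀ N x, ‖(A N).1 x‖ ≤ 1 * ‖x‖ := by
    intro N x
    rw [hA, birkhoffAverage, birkhoffSum, norm_smul, norm_inv, Complex.norm_natCast, one_mul,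
      inv_mul_le_iff₀ (by positivity)]
    refine (norm_sum_le _ _).trans ?_
    calc _ ≤ ∑ k ∈ Finset.range (N + 1), ‖x‖ := Finset.sum_le_sum fun k _ => ?_
      _ = _ := by simp
    clear * - hTn
    induction k with
    | zero => simp
    | succ k ih =>
      rw [Function.iterate_succ_apply']
      refine le_trans ?_ ih
      simpa using T.1.le_of_opNorm_le hTn _
  have hlim : ∀ x, Tendsto (fun N => (A N).1 x) atTop (𝓝 ((p.meet q).toAlg.1 x)) := by
    intro x
    have h := (tendsto_add_atTop_iff_nat 1).2
      (ContinuousLinearMap.tendsto_birkhoffAverage_orthogonalProjection T.1 hTn x)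
    simp_rw [hA]
    convert h using 2
    have hq := hasOrthogonalProjection_inf p.2.2 q.2.2
    change (p.1.range ⊓ q.1.range).starProjection x = _
    rw [← Submodule.starProjection_apply]
    congr 2
    exact (Proj.eqLocus_mul_mul p q).symm
  have hconv := (Complex.continuous_re.tendsto _).comp (hτ.tendsto_of_strongly hbound hlim)
  refine ge_of_tendsto' hconv fun N => ?_
  have hN : (0 : ℝ) < (N + 1 : ℕ) := by positivity
  have : (τ (A N)).re = ((N + 1 : ℕ) : ℝ)⁻¹ * ∑ k ∈ Finset.range (N + 1), (τ (T ^ k)).re := by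
    simp only [A, map_smul, map_sum, smul_eq_mul]
    rw [← Complex.re_sum, ← Complex.re_ofReal_mul]
    push_cast
    rfl
  simp only [Function.comp]
  rw [this, ← div_eq_inv_mul, le_div_iff₀ hN]
  calc _ = ∑ k ∈ Finset.range (N + 1), (tr τ p + tr τ q - 1) := by
        simp only [Finset.sum_const, Finset.card_range, nsmul_eq_mul]
        ring
    _ ≤ _ := Finset.sum_le_sum fun k _ => hτ.re_pow_ge k

end Trace

/-! ### Maximal chains of projections in a diffuse algebra -/

section Chains

variable {H : Type uH} [NormedAddCommGroup H] [InnerProductSpace ℂ H] [CompleteSpace H]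
  {M : VonNeumannAlgebra H} {τ : M.toStarSubalgebra →ₗ[ℂ] ℂ}

theorem Proj.exists_isLUB_of_monotone {d : ℕ → Proj M} (hd : Monotone d) :
    ∃ p : Proj M, IsLUB (Set.range d) p ∧ ∀ x, Tendsto (fun k => (d k).1 x) atTop (𝓝 (p.1 x)) := by
  let U : ℕ → Submodule ℂ H := fun k => (d k).1.range
  have hU : Monotone U := fun i j h => Proj.le_iff_range_le.1 (hd h)
  have hclosed : ∀ k, IsClosed (U k : Set H) := fun k =>
    ContinuousLinearMap.IsIdempotentElem.isClosed_range (d k).2.2.isIdempotentElem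
  have hcomplete : ∀ k, CompleteSpace (U k) := fun k => (hclosed k).completeSpace_coe
  have hstar : ∀ k, (U k).starProjection = (d k).1 := fun k =>
    ContinuousLinearMap.IsStarProjection.ext isStarProjection_starProjection (d k).2.2
      (Submodule.range_starProjection _)
  have hlim := Submodule.starProjection_tendsto_closure_iSup U hU
  simp_rw [hstar] at hlim
  set P := (⨆ i, U i).topologicalClosure.starProjection with hP
  have hPM : P ∈ M := by
    rw [← SetLike.mem_coe, ← M.centralizer_centralizer]
    intro y hy
    ext x
    refine tendsto_nhds_unique ((y.continuous.tendsto _).comp (hlim x)) ?_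
    refine (hlim (y x)).congr fun k => ?_
    exact DFunLike.congr_fun (hy (d k).1 (d k).2.1) x
  let p : Proj M := ⟨P, hPM, isStarProjection_starProjection⟩
  have hrange : p.1.range = (⨆ i, U i).topologicalClosure := Submodule.range_starProjection _
  refine ⟨p, ⟨?_, ?_⟩, hlim⟩
  · rintro _ ⟨k, rfl⟩
    rw [Proj.le_iff_range_le, hrange]
    exact (le_iSup U k).trans (Submodule.le_topologicalClosure _)
  · intro q hq
    rw [Proj.le_iff_range_le, hrange]
    refine Submodule.topologicalClosure_minimal _ (iSup_le fun k => ?_)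
      (ContinuousLinearMap.IsIdempotentElem.isClosed_range q.2.2.isIdempotentElem)
    exact Proj.le_iff_range_le.1 (hq ⟨k, rfl⟩)

/-- A set of projections is a maximal chain: its elements are exactly the projections comparable
to all of its elements. -/
def IsSaturatedChain (F : Set (Proj M)) : Prop :=
  ∀ a, a ∈ F ↔ ∀ b ∈ F, a ≤ b ∨ b ≤ a

theorem isSaturatedChain_flag (F : Flag (Proj M)) : IsSaturatedChain (F : Set (Proj M)) :=
  fun _ => Flag.mem_iff_forall_le_or_ge

theorem IsSaturatedChain.preimage_compl {F : Set (Proj M)} (hF : IsSaturatedChain F) :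
    IsSaturatedChain (Proj.compl ⁻¹' F) := by
  intro a
  rw [Set.mem_preimage, hF]
  constructor
  · intro h b hb
    rcases h _ hb with h | h
    · exact Or.inr (by simpa [Proj.compl_compl] using Proj.compl_le_compl h)
    · exact Or.inl (by simpa [Proj.compl_compl] using Proj.compl_le_compl h)
  · intro h b hb
    rcases h b.compl (by simpa [Proj.compl_compl] using hb) with h | h
    · exact Or.inr (by simpa [Proj.compl_compl] using Proj.compl_le_compl h)
    · exact Or.inl (by simpa [Proj.compl_compl] using Proj.compl_le_compl h)

/-- In a maximal chain of projections there is a largest one of trace at most `t`: by normality,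
the supremum of a sequence whose traces exhaust those not exceeding `t`. -/
theorem IsSaturatedChain.exists_greatest (hτ : IsNormalFaithfulTracialState M τ)
    {F : Set (Proj M)} (hF : IsSaturatedChain F) {t : ℝ} (ht : 0 ≤ t) :
    ∃ p, IsGreatest {d ∈ F | tr τ d ≤ t} p := by
  have hbot : (⊥ : Proj M) ∈ F := (hF _).2 fun b _ => Or.inl bot_le
  have hne : (tr τ '' {d ∈ F | tr τ d ≤ t}).Nonempty :=
    ⟨_, ⊥, ⟨hbot, by rw [tr_bot]; exact ht⟩, rfl⟩
  have hbdd : BddAbove (tr τ '' {d ∈ F | tr τ d ≤ t}) := by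
    refine ⟨t, ?_⟩
    rintro _ ⟨d, hd, rfl⟩
    exact hd.2
  obtain ⟨s, hsmono, hslim, hs⟩ := exists_seq_tendsto_sSup hne hbdd
  choose d hd hds using hs
  have hdmono : Monotone d := by
    intro i j hij
    rcases (hF _).1 (hd i).1 _ (hd j).1 with h | h
    · exact h
    · refine (hτ.eq_of_le_of_tr_le h ?_).ge
      rw [hds, hds]
      exact hsmono hij
  obtain ⟨p, hp, hlim⟩ := Proj.exists_isLUB_of_monotone hdmono
  have htrp : tr τ p = sSup (tr τ '' {d ∈ F | tr τ d ≤ t}) := by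
    have hconv := hτ.tendsto_of_strongly (a := fun k => (d k).toAlg) (b := p.toAlg) (C := 1)
      (fun k x => (d k).1.le_of_opNorm_le (d k).2.2.norm_le x) hlim
    refine tendsto_nhds_unique ((Complex.continuous_re.tendsto _).comp hconv) ?_
    exact hslim.congr fun k => (hds k).symm
  have hcomp : ∀ f ∈ F, p ≤ f ∨ f ≤ p := by
    intro f hf
    by_cases h : ∃ k, f ≤ d k
    · obtain ⟨k, hk⟩ := h
      exact Or.inr (hk.trans (hp.1 ⟨k, rfl⟩))
    · push Not at h
      left
      refine hp.2 ?_
      rintro _ ⟨k, rfl⟩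
      exact ((hF _).1 (hd k).1 f hf).resolve_right (h k)
  refine ⟨p, ⟨(hF p).2 hcomp, htrp.trans_le ?_⟩, ?_⟩
  · refine csSup_le hne ?_
    rintro _ ⟨d, hd, rfl⟩
    exact hd.2
  · rintro f ⟨hf, hft⟩
    rcases hcomp f hf with h | h
    · refine (hτ.eq_of_le_of_tr_le h ?_).ge
      rw [htrp]
      exact le_csSup hbdd ⟨f, ⟨hf, hft⟩, rfl⟩
    · exact h

/-- In a diffuse von Neumann algebra, the trace takes all values in `[0, 1]` on a maximal chain of
projections: a gap in the traces would be bridged by a minimal projection. -/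
theorem IsSaturatedChain.exists_tr_eq (hM : IsDiffuse M) (hτ : IsNormalFaithfulTracialState M τ)
    {F : Set (Proj M)} (hF : IsSaturatedChain F) {t : ℝ} (ht : t ∈ Set.Icc (0 : ℝ) 1) :
    ∃ p ∈ F, tr τ p = t := by
  obtain ⟨a, ⟨haF, hat⟩, ha⟩ := hF.exists_greatest hτ ht.1
  obtain ⟨b, ⟨hbF, hbt⟩, hb⟩ := hF.preimage_compl.exists_greatest hτ (sub_nonneg.2 ht.2)
  have hb' : ∀ f ∈ F, t ≤ tr τ f → b.compl ≤ f := by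
    intro f hf hft
    have : f.compl ≤ b := hb ⟨by simpa [Proj.compl_compl] using hf, by
      rw [hτ.tr_compl]; linarith⟩
    simpa [Proj.compl_compl] using Proj.compl_le_compl this
  have hbt' : t ≤ tr τ b.compl := by
    rw [hτ.tr_compl]
    change tr τ b ≤ 1 - t at hbt
    linarith
  change b.compl ∈ F at hbF
  change tr τ a ≤ t at hat
  generalize b.compl = c at hbF hb' hbt'
  have hac : a ≤ c := by
    rcases (hF _).1 haF _ hbF with h | h
    · exact h
    · exact (hτ.eq_of_le_of_tr_le h (hat.trans hbt')).ge
  by_cases h0 : a = c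
  · exact ⟨a, haF, le_antisymm hat (by rw [h0]; exact hbt')⟩
  exfalso
  obtain ⟨q, hq, hq0, hqne⟩ := hM (Proj.diff hac) fun h => h0 (Subtype.ext (sub_eq_zero.1 h).symm)
  have hqa : q ≤ a.compl := hq.trans (sub_le_sub_right c.2.2.le_one a.1)
  -- the projection `a + q` lies strictly between `a` and `c`
  have h1 : a ≤ Proj.add hqa := by
    change a.1 ≤ q.1 + a.1
    exact le_add_of_nonneg_left q.2.2.nonneg
  have h2 : Proj.add hqa ≤ c := by
    change q.1 + a.1 ≤ c.1
    exact le_sub_iff_add_le.1 hq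
  have hqF : Proj.add hqa ∈ F := by
    rw [hF]
    intro f hf
    rcases le_total (tr τ f) t with h | h
    · exact Or.inr ((ha ⟨hf, h⟩).trans h1)
    · exact Or.inl (h2.trans (hb' f hf h))
  rcases le_total (tr τ (Proj.add hqa)) t with h | h
  · have h3 : q.1 + a.1 = a.1 := congrArg Subtype.val ((ha ⟨hqF, h⟩).antisymm h1)
    exact hq0 (by simpa using h3)
  · have h3 : q.1 + a.1 = c.1 := congrArg Subtype.val (h2.antisymm (hb' _ hqF h))
    exact hqne (Subtype.ext (eq_sub_of_add_eq h3))

/-- Every chain of projections in a diffuse von Neumann algebra is absorbed by a flag: the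
projection `e t` lies below all members of the chain of trace at least `t`, and above all
members of trace at most `t`. -/
theorem exists_isFlag_of_isChain (hM : IsDiffuse M) (hτ : IsNormalFaithfulTracialState M τ)
    {C : Set (Proj M)} (hC : IsChain (· ≤ ·) C) :
    ∃ e : ℝ → Proj M, IsFlag τ e ∧ ∀ t ∈ Set.Icc (0 : ℝ) 1, ∀ c ∈ C,
      (t ≤ tr τ c → e t ≤ c) ∧ (tr τ c ≤ t → c ≤ e t) := by
  obtain ⟨F, hCF⟩ := hC.exists_subset_flag
  have hF := isSaturatedChain_flag F
  have hex : ∀ t : ℝ, ∃ p ∈ F, t ∈ Set.Icc (0 : ℝ) 1 → tr τ p = t := by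
    intro t
    by_cases ht : t ∈ Set.Icc (0 : ℝ) 1
    · obtain ⟨p, hp, h⟩ := hF.exists_tr_eq hM hτ ht
      exact ⟨p, hp, fun _ => h⟩
    · exact ⟨⊥, F.bot_mem, fun h => absurd h ht⟩
  choose e he het using hex
  refine ⟨e, ⟨fun s _ t _ => F.le_or_le (he s) (he t), het⟩, fun t ht c hc => ⟨fun h => ?_,
    fun h => ?_⟩⟩
  · rcases F.le_or_le (he t) (hCF hc) with h' | h'
    · exact h'
    · exact (hτ.eq_of_le_of_tr_le h' (by rwa [het t ht])).ge
  · rcases F.le_or_le (hCF hc) (he t) with h' | h'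
    · exact h'
    · exact (hτ.eq_of_le_of_tr_le h' (by rwa [het t ht])).ge

end Chains

/-! ### Corners of a von Neumann algebra -/

section Corner

variable {H : Type uH} [NormedAddCommGroup H] [InnerProductSpace ℂ H]

/-- The extension of an operator on a closed subspace `K` to an operator on `H`, by zero on the
orthogonal complement of `K`. -/
noncomputable def dilate (K : Submodule ℂ H) [CompleteSpace K] (x : K →L[ℂ] K) : H →L[ℂ] H :=
  K.subtypeL ∘L x ∘L K.orthogonalProjectionOnto

/-- The compression of an operator on `H` to a closed subspace `K`. -/
noncomputable def compress (K : Submodule ℂ H) [CompleteSpace K] (y : H →L[ℂ] H) : K →L[ℂ] K :=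
  K.orthogonalProjectionOnto ∘L y ∘L K.subtypeL

section

variable (K : Submodule ℂ H) [CompleteSpace K]

theorem dilate_apply (x : K →L[ℂ] K) (v : H) :
    dilate K x v = x (K.orthogonalProjectionOnto v) := rfl

theorem compress_dilate (x : K →L[ℂ] K) : compress K (dilate K x) = x := by
  ext v
  simp [compress, dilate]

theorem dilate_injective : Function.Injective (dilate K) :=
  Function.LeftInverse.injective (compress_dilate K)

theorem dilate_compress (y : H →L[ℂ] H) :
    dilate K (compress K y) = K.starProjection * y * K.starProjection := rfl

theorem dilate_mul (x y : K →L[ℂ] K) : dilate K (x * y) = dilate K x * dilate K y := by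
  ext v
  simp [dilate]

theorem dilate_zero : dilate K 0 = 0 := by
  ext v
  simp [dilate]

theorem dilate_add (x y : K →L[ℂ] K) : dilate K (x + y) = dilate K x + dilate K y := by
  ext v
  simp [dilate]

theorem dilate_smul (c : ℂ) (x : K →L[ℂ] K) : dilate K (c • x) = c • dilate K x := by
  ext v
  simp [dilate]

theorem dilate_one : dilate K 1 = K.starProjection := rfl

section

variable [CompleteSpace H]

theorem dilate_star (x : K →L[ℂ] K) : dilate K (star x) = star (dilate K x) := by
  simp only [ContinuousLinearMap.star_eq_adjoint, dilate, ContinuousLinearMap.adjoint_comp,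
    Submodule.adjoint_subtypeL, Submodule.adjoint_orthogonalProjectionOnto,
    ContinuousLinearMap.comp_assoc]

theorem compress_star (x : H →L[ℂ] H) : compress K (star x) = star (compress K x) := by
  simp only [ContinuousLinearMap.star_eq_adjoint, compress, ContinuousLinearMap.adjoint_comp,
    Submodule.adjoint_subtypeL, Submodule.adjoint_orthogonalProjectionOnto,
    ContinuousLinearMap.comp_assoc]

end

theorem starProjection_mul_dilate (x : K →L[ℂ] K) :
    K.starProjection * dilate K x = dilate K x := by
  rw [← dilate_one, ← dilate_mul, one_mul]

theorem dilate_mul_starProjection (x : K →L[ℂ] K) :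
    dilate K x * K.starProjection = dilate K x := by
  rw [← dilate_one, ← dilate_mul, mul_one]

theorem dilate_mul_dilate_compress {y : H →L[ℂ] H} (hy : Commute y K.starProjection)
    (x : K →L[ℂ] K) : dilate K x * dilate K (compress K y) = dilate K x * y := by
  rw [dilate_compress, mul_assoc, hy.eq, ← mul_assoc K.starProjection,
    K.isIdempotentElem_starProjection.eq, ← mul_assoc, dilate_mul_starProjection]

theorem dilate_compress_mul_dilate {y : H →L[ℂ] H} (hy : Commute y K.starProjection)
    (x : K →L[ℂ] K) : dilate K (compress K y) * dilate K x = y * dilate K x := by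
  rw [dilate_compress, mul_assoc, starProjection_mul_dilate, ← hy.eq, mul_assoc,
    starProjection_mul_dilate]

end

variable [CompleteSpace H] {M : VonNeumannAlgebra H}

instance (q : Proj M) : CompleteSpace q.1.range :=
  (ContinuousLinearMap.IsIdempotentElem.isClosed_range
    q.2.2.isIdempotentElem).completeSpace_coe

theorem Proj.starProjection_range (q : Proj M) : q.1.range.starProjection = q.1 :=
  ContinuousLinearMap.IsStarProjection.ext isStarProjection_starProjection q.2.2
    (Submodule.range_starProjection _)

/-- The corner `qMq`, acting on the range of the projection `q` of `M`. It is the commutant of the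
compressions to that range of the elements of the commutant of `M`. -/
noncomputable def corner (q : Proj M) : VonNeumannAlgebra q.1.range where
  carrier := {x | dilate q.1.range x ∈ M}
  mul_mem' {x y} hx hy := by
    change dilate _ _ ∈ M
    rw [dilate_mul]
    exact mul_mem hx hy
  add_mem' {x y} hx hy := by
    change dilate _ _ ∈ M
    rw [dilate_add]
    exact add_mem hx hy
  algebraMap_mem' c := by
    change dilate _ _ ∈ M
    rw [Algebra.algebraMap_eq_smul_one, dilate_smul, dilate_one, q.starProjection_range]
    exact M.toStarSubalgebra.smul_mem q.2.1 c
  star_mem' {x} hx := by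
    change dilate _ _ ∈ M
    rw [dilate_star]
    exact star_mem hx
  centralizer_centralizer' := by
    change Set.centralizer (Set.centralizer {x | dilate q.1.range x ∈ M}) =
      {x | dilate q.1.range x ∈ M}
    refine Set.Subset.antisymm (fun x hx => ?_) Set.subset_centralizer_centralizer
    change dilate q.1.range x ∈ M
    rw [← SetLike.mem_coe, ← M.centralizer_centralizer]
    intro y hy
    have hyq : Commute y q.1.range.starProjection := by
      rw [q.starProjection_range]
      exact (hy q.1 q.2.1).symm
    -- compressions of the commutant of `M` commute with the corner, hence with `x`
    have hc : compress q.1.range y ∈ Set.centralizer {x | dilate q.1.range x ∈ M} := by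
      intro z hz
      apply dilate_injective
      rw [dilate_mul, dilate_mul, dilate_mul_dilate_compress _ hyq,
        dilate_compress_mul_dilate _ hyq]
      exact hy _ hz
    have h := congrArg (dilate q.1.range) (hx _ hc)
    rwa [dilate_mul, dilate_mul, dilate_mul_dilate_compress _ hyq,
      dilate_compress_mul_dilate _ hyq] at h

theorem mem_corner_iff {q : Proj M} {x : q.1.range →L[ℂ] q.1.range} :
    x ∈ corner q ↔ dilate q.1.range x ∈ M := Iff.rfl

/-- A projection of the corner `qMq`, regarded as a projection of `M`. -/
noncomputable def liftProj {q : Proj M} (p : Proj (corner q)) : Proj M :=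
  ⟨dilate q.1.range p.1, p.2.1,
    ⟨by rw [IsIdempotentElem, ← dilate_mul, p.2.2.isIdempotentElem.eq],
      by rw [IsSelfAdjoint, ← dilate_star, p.2.2.isSelfAdjoint.star_eq]⟩⟩

theorem liftProj_le_iff {q : Proj M} {p p' : Proj (corner q)} :
    liftProj p ≤ liftProj p' ↔ p ≤ p' := by
  rw [Proj.le_iff_mul_eq_left, Proj.le_iff_mul_eq_left]
  change dilate _ _ * dilate _ _ = dilate _ _ ↔ _
  rw [← dilate_mul, (dilate_injective _).eq_iff]

theorem liftProj_le {q : Proj M} (p : Proj (corner q)) : liftProj p ≤ q := by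
  rw [Proj.le_iff_mul_eq_left]
  have h := dilate_mul_starProjection q.1.range p.1
  rwa [q.starProjection_range] at h

theorem exists_liftProj_eq {p q : Proj M} (h : p ≤ q) :
    ∃ p' : Proj (corner q), liftProj p' = p := by
  have hd : dilate q.1.range (compress q.1.range p.1) = p.1 := by
    rw [dilate_compress, q.starProjection_range, Proj.le_iff_mul_eq_right.1 h,
      Proj.le_iff_mul_eq_left.1 h]
  refine ⟨⟨compress q.1.range p.1, ?_, ⟨?_, ?_⟩⟩, Subtype.ext hd⟩
  · rw [mem_corner_iff, hd]
    exact p.2.1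
  · apply dilate_injective
    rw [dilate_mul, hd, p.2.2.isIdempotentElem.eq]
  · rw [IsSelfAdjoint, ← compress_star, p.2.2.isSelfAdjoint.star_eq]

theorem liftProj_eq_zero_iff {q : Proj M} {p : Proj (corner q)} : (liftProj p).1 = 0 ↔ p.1 = 0 := by
  change dilate _ _ = 0 ↔ _
  rw [← dilate_zero q.1.range, (dilate_injective _).eq_iff]

theorem IsDiffuse.corner (hM : IsDiffuse M) (q : Proj M) : IsDiffuse (corner q) := by
  intro p hp
  obtain ⟨s, hs, hs0, hsp⟩ := hM (liftProj p) (fun h => hp (liftProj_eq_zero_iff.1 h))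
  obtain ⟨s, rfl⟩ := exists_liftProj_eq (hs.trans (liftProj_le p))
  exact ⟨s, liftProj_le_iff.1 hs, fun h => hs0 (liftProj_eq_zero_iff.2 h),
    fun h => hsp (by rw [h])⟩

/-- Extension by zero as a linear map from `qMq` to `M`. -/
noncomputable def cornerInclusion (q : Proj M) :
    (corner q).toStarSubalgebra →ₗ[ℂ] M.toStarSubalgebra where
  toFun x := ⟨dilate q.1.range x.1, x.2⟩
  map_add' x y := Subtype.ext (dilate_add _ x.1 y.1)
  map_smul' c x := Subtype.ext (dilate_smul _ c x.1)

/-- The renormalized restriction of `τ` to the corner `qMq`. -/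
noncomputable def cornerTrace (τ : M.toStarSubalgebra →ₗ[ℂ] ℂ) (q : Proj M) :
    (corner q).toStarSubalgebra →ₗ[ℂ] ℂ :=
  (((tr τ q)⁻¹ : ℝ) : ℂ) • τ ∘ₗ cornerInclusion q

variable {τ : M.toStarSubalgebra →ₗ[ℂ] ℂ}

theorem tr_cornerTrace {q : Proj M} (p : Proj (corner q)) :
    tr (cornerTrace τ q) p = (tr τ q)⁻¹ * tr τ (liftProj p) :=
  Complex.re_ofReal_mul _ _

set_option maxHeartbeats 1000000 in
theorem IsNormalFaithfulTracialState.corner (hτ : IsNormalFaithfulTracialState M τ) {q : Proj M}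
    (hq : 0 < tr τ q) : IsNormalFaithfulTracialState (corner q) (cornerTrace τ q) := by
  have hmul : ∀ x y, cornerInclusion q (x * y) = cornerInclusion q x * cornerInclusion q y :=
    fun x y => Subtype.ext (dilate_mul _ x.1 y.1)
  have happ : ∀ x, cornerTrace τ q x = (((tr τ q)⁻¹ : ℝ) : ℂ) * τ (cornerInclusion q x) :=
    fun _ => rfl
  have hsq : ∀ x, cornerTrace τ q (star x * x) = (((tr τ q)⁻¹ : ℝ) : ℂ) *
      τ (star (cornerInclusion q x) * cornerInclusion q x) := by
    intro x
    rw [happ]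
    congr 2
    apply Subtype.ext
    change dilate _ (star x.1 * x.1) = star (dilate _ x.1) * dilate _ x.1
    rw [dilate_mul, dilate_star]
  have hc : (0 : ℝ) < (tr τ q)⁻¹ := inv_pos.2 hq
  refine ⟨?_, fun x => ?_, fun x => ?_, fun x hx => ?_, fun x y => ?_, ?_⟩
  · have h1 : cornerInclusion q 1 = q.toAlg := Subtype.ext q.starProjection_range
    have him : (τ q.toAlg).im = 0 := by
      rw [← q.star_mul_self_toAlg]
      exact hτ.nonneg_im _
    have h2 : τ q.toAlg = (tr τ q : ℂ) := Complex.ext rfl him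
    rw [happ, h1, h2, ← Complex.ofReal_mul, inv_mul_cancel₀ hq.ne', Complex.ofReal_one]
  · rw [hsq, Complex.re_ofReal_mul]
    exact mul_nonneg hc.le (hτ.nonneg_re (cornerInclusion q x))
  · rw [hsq, Complex.im_ofReal_mul]
    exact mul_eq_zero_of_right _ (hτ.nonneg_im (cornerInclusion q x))
  · rw [hsq] at hx
    have h0 := hτ.faithful (cornerInclusion q x)
      ((mul_eq_zero.1 hx).resolve_left (Complex.ofReal_ne_zero.2 hc.ne'))
    have h1 : dilate q.1.range x.1 = 0 := congrArg (fun x : M.toStarSubalgebra => x.1) h0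
    apply Subtype.ext
    exact dilate_injective _ (h1.trans (dilate_zero _).symm)
  · rw [happ, happ, hmul, hmul]
    exact congrArg _ (hτ.tracial (cornerInclusion q x) (cornerInclusion q y))
  · obtain ⟨ξ, η, hξ, hη, hsum⟩ := hτ.normal
    set K := q.1.range
    refine ⟨fun n => K.orthogonalProjectionOnto (ξ n),
      fun n => (((tr τ q)⁻¹ : ℝ) : ℂ) • K.orthogonalProjectionOnto (η n), ?_, ?_, fun x => ?_⟩
    · refine hξ.of_nonneg_of_le (fun n => by positivity) fun n => ?_
      gcongr
      exact K.norm_orthogonalProjectionOnto_apply_le _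
    · refine (hη.mul_left (((tr τ q)⁻¹) ^ 2)).of_nonneg_of_le (fun n => by positivity) fun n => ?_
      rw [norm_smul, mul_pow, Complex.norm_real, Real.norm_eq_abs, sq_abs]
      gcongr
      exact K.norm_orthogonalProjectionOnto_apply_le _
    · have hterm : ∀ n, ⟪K.orthogonalProjectionOnto (ξ n),
          x.1 ((((tr τ q)⁻¹ : ℝ) : ℂ) • K.orthogonalProjectionOnto (η n))⟫_ℂ =
          (((tr τ q)⁻¹ : ℝ) : ℂ) * ⟪ξ n, dilate K x.1 (η n)⟫_ℂ := by
        intro n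
        rw [map_smul, inner_smul_right, Submodule.inner_orthogonalProjectionOnto_eq_of_mem_right,
          dilate_apply]
      rw [happ]
      simp_rw [hterm]
      exact (hsum (cornerInclusion q x)).mul_left _

end Corner

/-! ### Index sets and their shifts -/

section IndexSets

theorem idx_image {r : ℕ} {g : ℕ → ℕ} (hg : StrictMonoOn g (Set.Icc 1 r)) {l : ℕ}
    (hl : l ∈ Finset.Icc 1 r) : idx ((Finset.Icc 1 r).image g) l = g l := by
  set S := (Finset.Icc 1 r).image g with hS
  have hinj : Set.InjOn g (Finset.Icc 1 r : Finset ℕ) := by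
    rw [Finset.coe_Icc]
    exact hg.injOn
  have hcard : S.card = r := by
    rw [hS, Finset.card_image_of_injOn hinj, Nat.card_Icc]
    simp
  have hf : (Set.ofPred (· ∈ S)).Finite := S.finite_toSet
  have hfS : hf.toFinset = S := by
    ext x
    rw [Set.Finite.mem_toFinset]
    rfl
  have hfc : hf.toFinset.card = r := by rw [hfS, hcard]
  rw [Finset.mem_Icc] at hl
  obtain ⟨k, rfl⟩ := Nat.exists_eq_add_of_le' hl.1
  have hk : k < hf.toFinset.card := by omega
  change Nat.nth (· ∈ S) k = g (k + 1)
  rw [Nat.nth_eq_orderEmbOfFin hf hk]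
  have huniq := Finset.orderEmbOfFin_unique (s := hf.toFinset) rfl
    (f := fun x : Fin hf.toFinset.card => g (x + 1)) (fun x => ?_) (fun x y hxy => ?_)
  · exact (congrFun huniq ⟨k, hk⟩).symm
  · have hx := x.2
    exact hfS.ge (Finset.mem_image_of_mem g (Finset.mem_Icc.2 (by omega)))
  · have hx := x.2
    have hy := y.2
    have hxy' : (x : ℕ) < y := hxy
    exact hg ⟨by omega, by omega⟩ ⟨by omega, by omega⟩ (by omega)

variable {n r : ℕ} {I : Finset ℕ}

theorem IsIndexSet.card_toFinset (hI : IsIndexSet n r I) (hf : (Set.ofPred (· ∈ I)).Finite) :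
    hf.toFinset.card = r := by
  have : hf.toFinset = I := by
    ext x
    rw [Set.Finite.mem_toFinset]
    rfl
  rw [this, hI.2]

theorem IsIndexSet.idx_mem (hI : IsIndexSet n r I) {l : ℕ} (hl : l ∈ Finset.Icc 1 r) :
    idx I l ∈ Finset.Icc 1 n := by
  rw [Finset.mem_Icc] at hl
  obtain ⟨k, rfl⟩ := Nat.exists_eq_add_of_le' hl.1
  refine hI.1 (Nat.nth_mem (p := (· ∈ I)) k fun hf => ?_)
  rw [hI.card_toFinset hf]
  omega

theorem IsIndexSet.idx_le (hI : IsIndexSet n r I) {l : ℕ} (hl : l ≤ r) : idx I l ≤ n := by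
  rcases Nat.eq_zero_or_pos l with rfl | h
  · exact Nat.zero_le _
  · exact (Finset.mem_Icc.1 (hI.idx_mem (Finset.mem_Icc.2 ⟨h, hl⟩))).2

theorem IsIndexSet.idx_strictMonoOn (hI : IsIndexSet n r I) :
    StrictMonoOn (idx I) (Set.Iic r) := by
  intro a _ b hb hab
  have hb' : b ≤ r := hb
  obtain ⟨m, rfl⟩ := Nat.exists_eq_add_of_le' (Nat.one_le_of_lt hab)
  rcases Nat.eq_zero_or_pos a with rfl | h
  · have := hI.idx_mem (Finset.mem_Icc.2 ⟨by omega, hb'⟩)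
    exact (Finset.mem_Icc.1 this).1
  · obtain ⟨k, rfl⟩ := Nat.exists_eq_add_of_le' h
    refine Nat.nth_lt_nth' (p := (· ∈ I)) (by omega) fun hf => ?_
    rw [hI.card_toFinset hf]
    omega

theorem IsIndexSet.shift_strictMonoOn (hI : IsIndexSet n r I) (u : ℕ) :
    StrictMonoOn (fun y => idx I y + if y ≤ u then 0 else 1) (Set.Icc 1 r) := by
  intro a ha b hb hab
  have := hI.idx_strictMonoOn ha.2 hb.2 hab
  dsimp only
  split_ifs <;> omega

theorem IsIndexSet.idx_shift (hI : IsIndexSet n r I) (u : ℕ) {l : ℕ} (hl : l ∈ Finset.Icc 1 r) :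
    idx (shift r I u) l = idx I l + if l ≤ u then 0 else 1 :=
  idx_image (hI.shift_strictMonoOn u) hl

theorem IsIndexSet.shift (hI : IsIndexSet n r I) (u : ℕ) :
    IsIndexSet (n + 1) r (shift r I u) := by
  constructor
  · intro x hx
    obtain ⟨y, hy, rfl⟩ := Finset.mem_image.1 hx
    have := Finset.mem_Icc.1 (hI.idx_mem hy)
    rw [Finset.mem_Icc]
    split_ifs <;> omega
  · rw [VNHorn.shift, Finset.card_image_of_injOn, Nat.card_Icc, Nat.add_sub_cancel]
    rw [Finset.coe_Icc]
    exact (hI.shift_strictMonoOn u).injOn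

end IndexSets

/-! ### Reduction to a corner -/

section Transfer

variable {H : Type uH} [NormedAddCommGroup H] [InnerProductSpace ℂ H] [CompleteSpace H]
  {M : VonNeumannAlgebra H} {τ : M.toStarSubalgebra →ₗ[ℂ] ℂ}

theorem IsFlag.mono (hτ : IsNormalFaithfulTracialState M τ) {e : ℝ → Proj M} (he : IsFlag τ e)
    {s t : ℝ} (hs : s ∈ Set.Icc (0 : ℝ) 1) (ht : t ∈ Set.Icc (0 : ℝ) 1) (hst : s ≤ t) :
    e s ≤ e t := by
  rcases he.1 s hs t ht with h | h
  · exact h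
  · refine (hτ.eq_of_le_of_tr_le h ?_).ge
    rwa [he.2 s hs, he.2 t ht]

/-- A flag in `M` induces a flag in the corner `qMq`, obtained by completing the chain of the
projections `q ∧ e s`. -/
theorem IsFlag.exists_corner (hM : IsDiffuse M) (hτ : IsNormalFaithfulTracialState M τ)
    {q : Proj M} (hq : 0 < tr τ q) {e : ℝ → Proj M} (he : IsFlag τ e) :
    ∃ e' : ℝ → Proj (corner q), IsFlag (cornerTrace τ q) e' ∧
      ∀ s ∈ Set.Icc (0 : ℝ) 1, ∀ t ∈ Set.Icc (0 : ℝ) 1,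
        tr τ q * t ≤ tr τ (q.meet (e s)) → liftProj (e' t) ≤ e s := by
  choose c hc using fun s => exists_liftProj_eq (Proj.meet_le_left q (e s))
  have hchain : IsChain (· ≤ ·) (c '' Set.Icc (0 : ℝ) 1) := by
    rintro _ ⟨s, hs, rfl⟩ _ ⟨t, ht, rfl⟩ _
    simp only [← liftProj_le_iff, hc]
    exact (he.1 s hs t ht).imp (Proj.meet_mono le_rfl) (Proj.meet_mono le_rfl)
  obtain ⟨e', he', hle⟩ := exists_isFlag_of_isChain (hM.corner q) (hτ.corner hq) hchain
  refine ⟨e', he', fun s hs t ht h => ?_⟩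
  have h1 : e' t ≤ c s := by
    refine (hle t ht _ ⟨s, hs, rfl⟩).1 ?_
    rwa [tr_cornerTrace, hc, ← div_eq_inv_mul, le_div_iff₀' hq]
  have h2 := liftProj_le_iff.2 h1
  rw [hc] at h2
  exact h2.trans (Proj.meet_le_right _ _)

variable {n r : ℕ} {I : Finset ℕ} {u : ℕ} {q : Proj M}

/-- If `q` has trace `n / (n + 1)` and dominates `e (i_u / (n + 1))`, then the solutions for `I` in
the corner `qMq` are solutions for the shifted index set in `M`. For `l ≤ u` the projection
`q ∧ e (i_l / (n + 1))` is `e (i_l / (n + 1))`, and for `l > u` the trace of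
`q ∧ e ((i_l + 1) / (n + 1))` is at least `i_l / (n + 1)`. -/
theorem exists_corner_flag_meetsFlag (hM : IsDiffuse M) (hτ : IsNormalFaithfulTracialState M τ)
    (hn : 1 ≤ n) (hI : IsIndexSet n r I) (hu : u ≤ r)
    (hq : tr τ q = (n : ℝ) / (n + 1 : ℕ)) {e : ℝ → Proj M} (he : IsFlag τ e)
    (heq : e ((idx I u : ℝ) / (n + 1 : ℕ)) ≤ q) :
    ∃ e' : ℝ → Proj (corner q), IsFlag (cornerTrace τ q) e' ∧ ∀ p : Proj (corner q),
      MeetsFlag (cornerTrace τ q) n r I e' p →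
        MeetsFlag τ (n + 1) r (shift r I u) e (liftProj p) := by
  have hn0 : (0 : ℝ) < n := by exact_mod_cast hn
  have hn1 : (0 : ℝ) < (n + 1 : ℕ) := by positivity
  have hq0 : 0 < tr τ q := by rw [hq]; positivity
  have hmem : ∀ k ≤ n + 1, (k : ℝ) / (n + 1 : ℕ) ∈ Set.Icc (0 : ℝ) 1 := by
    intro k hk
    refine ⟨by positivity, (div_le_one hn1).2 (by exact_mod_cast hk)⟩
  obtain ⟨e', he', hle⟩ := he.exists_corner hM hτ hq0
  refine ⟨e', he', fun p hp l hl => ?_⟩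
  have hil := (Finset.mem_Icc.1 (hI.idx_mem hl)).2
  have hlr := Finset.mem_Icc.1 hl
  have ht : (idx I l : ℝ) / n ∈ Set.Icc (0 : ℝ) 1 :=
    ⟨by positivity, (div_le_one hn0).2 (by exact_mod_cast hil)⟩
  have hqt : tr τ q * ((idx I l : ℝ) / n) = (idx I l : ℝ) / (n + 1 : ℕ) := by
    rw [hq]; field_simp
  have key : liftProj (e' ((idx I l : ℝ) / n)) ≤
      e ((idx (shift r I u) l : ℝ) / (n + 1 : ℕ)) := by
    rw [hI.idx_shift u hl]
    by_cases hlu : l ≤ u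
    · rw [if_pos hlu, add_zero]
      have hs := hmem (idx I l) (by omega)
      refine hle _ hs _ ht ?_
      rw [hqt]
      have h1 : e ((idx I l : ℝ) / (n + 1 : ℕ)) ≤ e ((idx I u : ℝ) / (n + 1 : ℕ)) := by
        refine he.mono hτ hs (hmem _ ((hI.idx_le hu).trans (Nat.le_succ n))) ?_
        gcongr
        exact hI.idx_strictMonoOn.monotoneOn hlr.2 hu hlu
      rw [← he.2 _ hs]
      exact hτ.tr_mono (Proj.le_meet_iff.2 ⟨h1.trans heq, by rw [he.2 _ hs]⟩)
    · rw [if_neg hlu]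
      have hs := hmem (idx I l + 1) (by omega)
      refine hle _ hs _ ht ?_
      rw [hqt]
      refine le_trans (le_of_eq ?_) (hτ.tr_meet_ge q _)
      rw [he.2 _ hs, hq]
      push_cast
      field_simp
      ring
  have h1 : liftProj ((e' ((idx I l : ℝ) / n)).meet p) ≤
      (e ((idx (shift r I u) l : ℝ) / (n + 1 : ℕ))).meet (liftProj p) :=
    Proj.le_meet_iff.2 ⟨(liftProj_le_iff.2 (Proj.meet_le_left _ _)).trans key,
      liftProj_le_iff.2 (Proj.meet_le_right _ _)⟩
  refine le_trans ?_ (hτ.tr_mono h1)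
  have h2 := hp l hl
  rw [tr_cornerTrace, ← div_eq_inv_mul, le_div_iff₀' hq0, hq] at h2
  refine le_trans (le_of_eq ?_) h2
  field_simp

/-- Projections whose traces add up to at most `t` lie below a common projection of trace `t`. -/
theorem exists_ge_of_tr_add_le (hM : IsDiffuse M) (hτ : IsNormalFaithfulTracialState M τ)
    {a b c : Proj M} {t : ℝ} (ht : t ≤ 1) (h : tr τ a + tr τ b + tr τ c ≤ t) :
    ∃ q : Proj M, tr τ q = t ∧ a ≤ q ∧ b ≤ q ∧ c ≤ q := by
  -- the complement of `m` is the supremum of `a`, `b`, `c`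
  set m := (a.compl.meet b.compl).meet c.compl with hm
  have hmtr : 1 - t ≤ tr τ m := by
    have h1 := hτ.tr_meet_ge a.compl b.compl
    have h2 := hτ.tr_meet_ge (a.compl.meet b.compl) c.compl
    rw [hτ.tr_compl] at h1 h2
    rw [hτ.tr_compl] at h1
    linarith
  have hle : ∀ {p : Proj M}, m ≤ p.compl → p ≤ m.compl := fun h => by
    simpa [Proj.compl_compl] using Proj.compl_le_compl h
  have ha : a ≤ m.compl := hle ((Proj.meet_le_left _ _).trans (Proj.meet_le_left _ _))
  have hb : b ≤ m.compl := hle ((Proj.meet_le_left _ _).trans (Proj.meet_le_right _ _))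
  have hc : c ≤ m.compl := hle (Proj.meet_le_right _ _)
  obtain ⟨e, he, hem⟩ := exists_isFlag_of_isChain hM hτ
    (Set.subsingleton_singleton (a := m.compl)).isChain
  have ht0 : t ∈ Set.Icc (0 : ℝ) 1 :=
    ⟨by linarith [hτ.tr_nonneg a, hτ.tr_nonneg b, hτ.tr_nonneg c], ht⟩
  have hmt : m.compl ≤ e t := (hem t ht0 _ rfl).2 (by rw [hτ.tr_compl]; linarith)
  exact ⟨e t, he.2 t ht0, ha.trans hmt, hb.trans hmt, hc.trans hmt⟩

/-- The reduction from `M` to a corner of trace `n / (n + 1)`, for three flags. -/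
theorem exists_corner_flags (hM : IsDiffuse M) (hτ : IsNormalFaithfulTracialState M τ)
    (hn : 1 ≤ n) {I J K : Finset ℕ} (hI : IsIndexSet n r I) (hJ : IsIndexSet n r J)
    (hK : IsIndexSet n r K) {u v w : ℕ} (hu : u ≤ r) (hv : v ≤ r) (hw : w ≤ r)
    (huvw : idx I u + idx J v + idx K w ≤ n) {e f g : ℝ → Proj M} (he : IsFlag τ e)
    (hf : IsFlag τ f) (hg : IsFlag τ g) :
    ∃ q : Proj M, tr τ q = (n : ℝ) / (n + 1 : ℕ) ∧ ∃ e' f' g' : ℝ → Proj (corner q),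
      IsFlag (cornerTrace τ q) e' ∧ IsFlag (cornerTrace τ q) f' ∧ IsFlag (cornerTrace τ q) g' ∧
      ∀ p : Proj (corner q),
        MeetsFlag (cornerTrace τ q) n r I e' p ∧ MeetsFlag (cornerTrace τ q) n r J f' p ∧
          MeetsFlag (cornerTrace τ q) n r K g' p →
        MeetsFlag τ (n + 1) r (shift r I u) e (liftProj p) ∧
          MeetsFlag τ (n + 1) r (shift r J v) f (liftProj p) ∧
          MeetsFlag τ (n + 1) r (shift r K w) g (liftProj p) := by
  have hn1 : (0 : ℝ) < (n + 1 : ℕ) := by positivity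
  have hmem : ∀ k ≤ n, (k : ℝ) / (n + 1 : ℕ) ∈ Set.Icc (0 : ℝ) 1 := by
    intro k hk
    exact ⟨by positivity, (div_le_one hn1).2 (by exact_mod_cast hk.trans (Nat.le_succ n))⟩
  obtain ⟨q, hq, heq, hfq, hgq⟩ := exists_ge_of_tr_add_le hM hτ
    (a := e ((idx I u : ℝ) / (n + 1 : ℕ))) (b := f ((idx J v : ℝ) / (n + 1 : ℕ)))
    (c := g ((idx K w : ℝ) / (n + 1 : ℕ))) (hmem n le_rfl).2 (by
      rw [he.2 _ (hmem _ (by omega)), hf.2 _ (hmem _ (by omega)), hg.2 _ (hmem _ (by omega)),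
        ← add_div, ← add_div]
      gcongr
      exact_mod_cast huvw)
  obtain ⟨e', he', hep⟩ := exists_corner_flag_meetsFlag hM hτ hn hI hu hq he heq
  obtain ⟨f', hf', hfp⟩ := exists_corner_flag_meetsFlag hM hτ hn hJ hv hq hf hfq
  obtain ⟨g', hg', hgp⟩ := exists_corner_flag_meetsFlag hM hτ hn hK hw hq hg hgq
  exact ⟨q, hq, e', f', g', he', hf', hg', fun p hp => ⟨hep p hp.1, hfp p hp.2.1, hgp p hp.2.2⟩⟩

end Transfer

end VNHorn

theorem mainTheorem3 (n r : ℕ) (hr : 1 ≤ r) (hrn : r ≤ n) (I J K : Finset ℕ)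
    (hI : VNHorn.IsIndexSet n r I) (hJ : VNHorn.IsIndexSet n r J) (hK : VNHorn.IsIndexSet n r K)
    (u v w : ℕ) (hu : u ≤ r) (hv : v ≤ r) (hw : w ≤ r)
    (huvw : VNHorn.idx I u + VNHorn.idx J v + VNHorn.idx K w ≤ n) :
    (VNHorn.IsIndexSet (n + 1) r (VNHorn.shift r I u) ∧
      VNHorn.IsIndexSet (n + 1) r (VNHorn.shift r J v) ∧
      VNHorn.IsIndexSet (n + 1) r (VNHorn.shift r K w)) ∧
    (VNHorn.PropertyP.{uH} n r I J K →
      VNHorn.PropertyP.{uH} (n + 1) r (VNHorn.shift r I u) (VNHorn.shift r J v)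
        (VNHorn.shift r K w)) ∧
    (VNHorn.PropertyAP.{uH} n r I J K →
      VNHorn.PropertyAP.{uH} (n + 1) r (VNHorn.shift r I u) (VNHorn.shift r J v)
        (VNHorn.shift r K w)) := by
  have hn : 1 ≤ n := hr.trans hrn
  have hn0 : (0 : ℝ) < n := by exact_mod_cast hn
  have hn1 : (0 : ℝ) < (n + 1 : ℕ) := by positivity
  have hquot : (0 : ℝ) < (n : ℝ) / (n + 1 : ℕ) := div_pos hn0 hn1
  have hrq : (n : ℝ) / (n + 1 : ℕ) * (r / n) = r / (n + 1 : ℕ) := by field_simp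
  refine ⟨⟨hI.shift u, hJ.shift v, hK.shift w⟩, ?_, ?_⟩
  · intro hP H _ _ _ M τ hM hτ e f g he hf hg
    obtain ⟨q, hq, e', f', g', he', hf', hg', hlift⟩ :=
      VNHorn.exists_corner_flags hM hτ hn hI hJ hK hu hv hw huvw he hf hg
    have hq0 : 0 < VNHorn.tr τ q := hq ▸ hquot
    obtain ⟨p, hp, hmeets⟩ := hP _ (VNHorn.corner q) (VNHorn.cornerTrace τ q) (hM.corner q)
      (hτ.corner hq0) e' f' g' he' hf' hg'
    refine ⟨VNHorn.liftProj p, ?_, hlift p hmeets⟩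
    rw [VNHorn.tr_cornerTrace, inv_mul_eq_iff_eq_mul₀ hq0.ne', hq, hrq] at hp
    exact hp
  · intro hP H _ _ _ M τ hM hτ e f g he hf hg ε hε
    obtain ⟨q, hq, e', f', g', he', hf', hg', hlift⟩ :=
      VNHorn.exists_corner_flags hM hτ hn hI hJ hK hu hv hw huvw he hf hg
    have hq0 : 0 < VNHorn.tr τ q := hq ▸ hquot
    obtain ⟨p, hp, hmeets⟩ := hP _ (VNHorn.corner q) (VNHorn.cornerTrace τ q) (hM.corner q)
      (hτ.corner hq0) e' f' g' he' hf' hg' ε hε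
    refine ⟨VNHorn.liftProj p, ?_, hlift p hmeets⟩
    rw [VNHorn.tr_cornerTrace, ← div_eq_inv_mul, div_le_iff₀' hq0, mul_add, hq, hrq] at hp
    -- the corner has trace at most `1`, so `ε` need not be rescaled
    have hle : (n : ℝ) / (n + 1 : ℕ) ≤ 1 := hq ▸ hτ.tr_le_one q
    exact hp.trans (add_le_add_right (mul_le_of_le_one_left hε.le hle) _)
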